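/- Let $n = 2^{k_0}+2^{k_1}+\dots+2^{k_m}$ with $0\le k_0<k_1<\dots<k_m$, let $P=\mathrm{Syl}_2 S_n$ be any Sylow $2$-subgroup of the symmetric group $S_n$ on $\{1,\dots,n\}$, fix an index $i$ with $k_i>2$, and let $Q=\mathrm{Syl}_2 S_{2^{k_i}}$ be any Sylow $2$-subgroup of $S_{2^{k_i}}$. Then $P$ has exactly one orbit $O$ on $\{1,\dots,n\}$ with $|O|=2^{k_i}$. Let $F\le P$ be the factor of $P$ on $O$, that is, the subgroup of all elements of $P$ that fix every point outside $O$. Then $F$ is normal in $P$ and isomorphic to $Q$, the centralizer of $F$ in $P$ satisfies $$C_P(F)\;\cong\;(P/F)\times Z(Q),$$ that is, $C_{\mathrm{Syl}_2 S_n}(\mathrm{Syl}_2 S_{2^{k_i}})\cong \bigl(\mathrm{Syl}_2 S_n/\mathrm{Syl}_2 S_{2^{k_i}}\bigr)\times Z(\mathrm{Syl}_2 S_{2^{k_i}})$, and the center $Z(Q)$ is isomorphic to the cyclic group $C_2$ of order $2$. -/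

import Mathlib

/-- `O` is one of the orbits of the permutation group `H` on `α`. -/
def IsOrbitOf {α : Type*} (H : Subgroup (Equiv.Perm α)) (O : Set α) : Prop :=
  ∃ x : α, O = MulAction.orbit H x

/-- The factor of the permutation group `H` on the block `O`: the subgroup of `H` of all elements
that fix every point outside `O`. If `H` is the direct product of permutation groups acting on
pairwise disjoint blocks and `O` is one of these blocks, this is the direct factor belonging
to `O`. -/
def blockFactor {α : Type*} (H : Subgroup (Equiv.Perm α)) (O : Set α) : Subgroup H :=
  (fixingSubgroup (Equiv.Perm α) Oᶜ).subgroupOf H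

/-! A Sylow subgroup contains every `p`-subgroup that it normalizes. So if `P` preserves `O`,
restricting its elements to `O` and extending by the identity stays inside `P`: this retracts `P`
onto the factor `F`. The kernel `K` centralizes `F` and `P = K × F`, whence `C_P(F) = K × Z(F) ≅
(P/F) × Z(F)`. The restriction of `P` to `O` is Sylow in `Perm O`, so `F ≅ Q`.

By Lucas, `n.choose (2 ^ k i)` is odd, so `P` fixes some set of `2 ^ k i` points; a Sylow subgroup
is transitive on a prime power number of points, so this set is an orbit. Absorption also gives the
center: for a central involution `ζ`, all the transpositions `(x ζx)` lie in `Q`, which leaves only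
`1` and `ζ`. -/

section SylowOfSymmetricGroup

open MulAction Equiv.Perm
open scoped Pointwise

/-! ### Centralizers of retracts, and absorption into Sylow subgroups. -/

section Retraction

variable {G : Type*} [Group G] {F : Subgroup G}

/-- A retraction onto a normal subgroup identifies its centralizer with the product of the quotient
and the center of the subgroup. -/
theorem nonempty_centralizer_mulEquiv_of_retraction (hF : F.Normal) (r : G →* F)
    (hr : ∀ f : F, r f = f) :
    Nonempty (Subgroup.centralizer (F : Set G) ≃* (G ⧸ F) × Subgroup.center F) := by
  have hdisj : Disjoint r.ker F := by
    rw [Subgroup.disjoint_def]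
    intro x hx hxF
    have h := hr ⟨x, hxF⟩
    rw [MonoidHom.mem_ker.1 hx] at h
    exact (congrArg Subtype.val h).symm
  have hcomm : ∀ x ∈ r.ker, x ∈ Subgroup.centralizer (F : Set G) := fun x hx ↦
    Subgroup.mem_centralizer_iff.2 fun f hf ↦
      ((Subgroup.commute_of_normal_of_disjoint _ _ inferInstance hF hdisj x f hx hf).eq).symm
  let c : Subgroup.centralizer (F : Set G) →* Subgroup.center F :=
    (r.comp (Subgroup.subtype _)).codRestrict _ fun x ↦ by
      rw [Subgroup.mem_center_iff]
      intro f
      have h := congrArg r (Subgroup.mem_centralizer_iff.1 x.2 f f.2)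
      rw [map_mul, map_mul, hr] at h
      exact h
  have hc (x) : ((c x : F)) = r x := rfl
  let φ := ((QuotientGroup.mk' F).comp (Subgroup.subtype (Subgroup.centralizer (F : Set G)))).prod c
  refine ⟨MulEquiv.ofBijective φ ⟨?_, ?_⟩⟩
  · rw [injective_iff_map_eq_one]
    intro x hx
    have h1 : (x : G) ∈ F := (QuotientGroup.eq_one_iff _).1 (congrArg Prod.fst hx)
    have h2 : r x = 1 := congrArg Subtype.val (congrArg Prod.snd hx)
    have h3 := hr ⟨x, h1⟩
    rw [h2] at h3
    exact Subtype.ext (congrArg Subtype.val h3).symm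
  · rintro ⟨q, z⟩
    obtain ⟨g, rfl⟩ := QuotientGroup.mk_surjective q
    have hk : g * (r g : G)⁻¹ ∈ r.ker := by
      rw [MonoidHom.mem_ker, map_mul, map_inv, hr, mul_inv_cancel]
    have hz : ((z : F) : G) ∈ Subgroup.centralizer (F : Set G) := by
      rw [Subgroup.mem_centralizer_iff]
      intro f hf
      exact congrArg Subtype.val (Subgroup.mem_center_iff.1 z.2 ⟨f, hf⟩)
    -- Modulo `F`, `g` equals its component in `ker r`, which centralizes `F`; the factor `z` sets
    -- the value of `r`.
    refine ⟨⟨g * (r g : G)⁻¹ * (z : F), mul_mem (hcomm _ hk) hz⟩, Prod.ext ?_ ?_⟩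
    · refine QuotientGroup.eq.2 ?_
      have h : (g * (r g : G)⁻¹ * (z : F))⁻¹ * g = ((z : F) : G)⁻¹ * (r g : G) := by group
      show (g * (r g : G)⁻¹ * (z : F))⁻¹ * g ∈ F
      rw [h]
      exact mul_mem (inv_mem (z : F).2) (r g).2
    · refine Subtype.ext ?_
      show r (g * (r g : G)⁻¹ * (z : F)) = z
      rw [map_mul, MonoidHom.mem_ker.1 hk, one_mul, hr]

end Retraction

/-- The join `P ⊔ E` is again a `p`-group, so maximality of `P` applies. -/
theorem Sylow.le_of_le_normalizer {p : ℕ} {G : Type*} [Group G] (P : Sylow p G) {E : Subgroup G}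
    (hE : IsPGroup p E) (h : (P : Subgroup G) ≤ Subgroup.normalizer (E : Set G)) :
    E ≤ P := by
  have := P.is_maximal' (P.isPGroup'.to_sup_of_normal_right' hE h) le_sup_left
  exact this ▸ le_sup_right

theorem Subgroup.le_normalizer_of_conj_mem {G : Type*} [Group G] {H K : Subgroup G}
    (h : ∀ g ∈ H, ∀ x ∈ K, g * x * g⁻¹ ∈ K) : H ≤ Subgroup.normalizer (K : Set G) := by
  intro g hg
  rw [Subgroup.mem_normalizer_iff]
  refine fun x ↦ ⟨h g hg x, fun hx ↦ ?_⟩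
  have := h g⁻¹ (inv_mem hg) _ hx
  simpa [mul_assoc] using this

/-! ### Factors of a Sylow subgroup on invariant sets. -/

section Restriction

variable {α : Type*}

/-- Restriction of the permutations stabilizing a set to that set. -/
def restrictHom (O : Set α) : stabilizer (Equiv.Perm α) O →* Equiv.Perm O :=
  MonoidHom.mk' (fun g ↦ subtypePerm g.1 (mem_stabilizer_set.1 g.2)) fun _ _ ↦ rfl

open scoped Classical in
theorem restrictHom_surjective (O : Set α) : Function.Surjective (restrictHom O) := fun σ ↦
  ⟨⟨ofSubtype σ, mem_stabilizer_set.2 (ofSubtype_apply_mem_iff_mem σ)⟩,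
    subtypePerm_ofSubtype σ⟩

/-- The restriction of a Sylow subgroup to an invariant set. -/
noncomputable def Sylow.restrict [Finite α] {p : ℕ} [Fact p.Prime] (P : Sylow p (Equiv.Perm α)) (O : Set α)
    (hO : (P : Subgroup (Equiv.Perm α)) ≤ stabilizer (Equiv.Perm α) O) : Sylow p (Equiv.Perm O) :=
  (P.subtype hO).mapSurjective (restrictHom_surjective O)

theorem Sylow.mem_restrict [Finite α] {p : ℕ} [Fact p.Prime] {P : Sylow p (Equiv.Perm α)} {O : Set α}
    {hO : (P : Subgroup (Equiv.Perm α)) ≤ stabilizer (Equiv.Perm α) O} {σ : Equiv.Perm O} :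
    σ ∈ P.restrict O hO ↔ ∃ g, ∃ hg : g ∈ P, restrictHom O ⟨g, hO hg⟩ = σ := by
  change σ ∈ ((P.subtype hO).mapSurjective (restrictHom_surjective O) : Subgroup _) ↔ _
  rw [Sylow.coe_mapSurjective, Subgroup.mem_map]
  constructor
  · rintro ⟨g, hg, rfl⟩
    exact ⟨g, hg, rfl⟩
  · rintro ⟨g, hg, rfl⟩
    exact ⟨⟨g, hO hg⟩, hg, rfl⟩

-- The extended restrictions form a `p`-group, a homomorphic image of `P`, and `P` normalizes it
-- because it preserves `O`; hence `P` absorbs it.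
open scoped Classical in
theorem Sylow.ofSubtype_restrictHom_mem {p : ℕ} (P : Sylow p (Equiv.Perm α)) {O : Set α}
    (hO : (P : Subgroup (Equiv.Perm α)) ≤ stabilizer (Equiv.Perm α) O)
    {g : Equiv.Perm α} (hg : g ∈ P) : ofSubtype (restrictHom O ⟨g, hO hg⟩) ∈ P := by
  let f : P →* Equiv.Perm α :=
    (ofSubtype (p := (· ∈ O))).comp ((restrictHom O).comp (Subgroup.inclusion hO))
  have hE : IsPGroup p f.range := by
    rw [MonoidHom.range_eq_map]
    exact (P.isPGroup'.of_equiv Subgroup.topEquiv.symm).map f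
  refine P.le_of_le_normalizer hE (Subgroup.le_normalizer_of_conj_mem ?_) ⟨⟨g, hg⟩, rfl⟩
  rintro a ha _ ⟨b, rfl⟩
  refine ⟨⟨a, ha⟩ * b * ⟨a, ha⟩⁻¹, ?_⟩
  have hinv (x : α) : a⁻¹ x ∈ O ↔ x ∈ O := mem_stabilizer_set.1 (hO (inv_mem ha)) x
  ext x
  by_cases hx : x ∈ O
  · have h1 : f (⟨a, ha⟩ * b * ⟨a, ha⟩⁻¹) x = a ((b : Equiv.Perm α) (a⁻¹ x)) :=
      ofSubtype_apply_of_mem _ hx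
    have h2 : f b (a⁻¹ x) = (b : Equiv.Perm α) (a⁻¹ x) :=
      ofSubtype_apply_of_mem _ ((hinv x).2 hx)
    rw [h1, Equiv.Perm.mul_apply, Equiv.Perm.mul_apply, h2]
  · have h1 : f (⟨a, ha⟩ * b * ⟨a, ha⟩⁻¹) x = x := ofSubtype_apply_of_not_mem _ hx
    have h2 : f b (a⁻¹ x) = a⁻¹ x := ofSubtype_apply_of_not_mem _ (mt (hinv x).1 hx)
    rw [h1, Equiv.Perm.mul_apply, Equiv.Perm.mul_apply, h2, ← Equiv.Perm.mul_apply, mul_inv_cancel,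
      Equiv.Perm.one_apply]

theorem mem_blockFactor {H : Subgroup (Equiv.Perm α)} {O : Set α} {g : H} :
    g ∈ blockFactor H O ↔ ∀ x ∉ O, (g : Equiv.Perm α) x = x := by
  rw [blockFactor, Subgroup.mem_subgroupOf, mem_fixingSubgroup_iff]
  rfl

theorem blockFactor_normal {H : Subgroup (Equiv.Perm α)} {O : Set α}
    (hO : H ≤ stabilizer (Equiv.Perm α) O) : (blockFactor H O).Normal := by
  refine ⟨fun f hf g ↦ mem_blockFactor.2 fun x hx ↦ ?_⟩
  have hg : (g : Equiv.Perm α)⁻¹ x ∉ O :=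
    mt (mem_stabilizer_set.1 (hO (inv_mem g.2)) x).1 hx
  show (g : Equiv.Perm α) ((f : Equiv.Perm α) ((g : Equiv.Perm α)⁻¹ x)) = x
  rw [mem_blockFactor.1 hf _ hg, ← Equiv.Perm.mul_apply, mul_inv_cancel, Equiv.Perm.one_apply]

open scoped Classical in
/-- The projection of a Sylow subgroup of a symmetric group onto its factor on an invariant set. -/
noncomputable def Sylow.toBlockFactor {p : ℕ} (P : Sylow p (Equiv.Perm α)) (O : Set α)
    (hO : (P : Subgroup (Equiv.Perm α)) ≤ stabilizer (Equiv.Perm α) O) :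
    P →* blockFactor (P : Subgroup (Equiv.Perm α)) O :=
  (((ofSubtype (p := (· ∈ O))).comp ((restrictHom O).comp (Subgroup.inclusion hO))).codRestrict
    (P : Subgroup (Equiv.Perm α)) fun g ↦ P.ofSubtype_restrictHom_mem hO g.2).codRestrict
    (blockFactor (P : Subgroup (Equiv.Perm α)) O) fun _ ↦
      mem_blockFactor.2 fun _ hx ↦ ofSubtype_apply_of_not_mem _ hx

theorem Sylow.toBlockFactor_apply_of_mem {p : ℕ} (P : Sylow p (Equiv.Perm α)) {O : Set α}
    (hO : (P : Subgroup (Equiv.Perm α)) ≤ stabilizer (Equiv.Perm α) O) (g : P) {x : α}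
    (hx : x ∈ O) : ((P.toBlockFactor O hO g : P) : Equiv.Perm α) x = (g : Equiv.Perm α) x := by
  classical
  exact ofSubtype_apply_of_mem _ hx

theorem Sylow.toBlockFactor_coe {p : ℕ} (P : Sylow p (Equiv.Perm α)) {O : Set α}
    (hO : (P : Subgroup (Equiv.Perm α)) ≤ stabilizer (Equiv.Perm α) O)
    (f : blockFactor (P : Subgroup (Equiv.Perm α)) O) : P.toBlockFactor O hO f = f := by
  refine Subtype.ext (Subtype.ext (Equiv.ext fun x ↦ ?_))
  by_cases hx : x ∈ O
  · exact P.toBlockFactor_apply_of_mem hO f hx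
  · exact (mem_blockFactor.1 (P.toBlockFactor O hO f).2 x hx).trans
      (mem_blockFactor.1 f.2 x hx).symm

theorem Sylow.nonempty_blockFactor_mulEquiv_restrict [Finite α] {p : ℕ} [Fact p.Prime]
    (P : Sylow p (Equiv.Perm α)) {O : Set α}
    (hO : (P : Subgroup (Equiv.Perm α)) ≤ stabilizer (Equiv.Perm α) O) :
    Nonempty (blockFactor (P : Subgroup (Equiv.Perm α)) O ≃* P.restrict O hO) := by
  let φ : blockFactor (P : Subgroup (Equiv.Perm α)) O →* P.restrict O hO :=
    (((restrictHom O).comp (Subgroup.inclusion hO)).comp (Subgroup.subtype _)).codRestrict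
      (P.restrict O hO : Subgroup (Equiv.Perm O))
      fun f ↦ Sylow.mem_restrict.2 ⟨(f : P), (f : P).2, rfl⟩
  have hφ (f) (x : O) : (((φ f : Equiv.Perm O) x : O) : α) = ((f : P) : Equiv.Perm α) x := rfl
  refine ⟨MulEquiv.ofBijective φ ⟨?_, ?_⟩⟩
  · intro f g hfg
    refine Subtype.ext (Subtype.ext (Equiv.ext fun x ↦ ?_))
    by_cases hx : x ∈ O
    · rw [← hφ f ⟨x, hx⟩, ← hφ g ⟨x, hx⟩, hfg]
    · exact (mem_blockFactor.1 f.2 x hx).trans (mem_blockFactor.1 g.2 x hx).symm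
  · rintro ⟨σ, hσ⟩
    obtain ⟨g, hg, rfl⟩ := Sylow.mem_restrict.1 hσ
    refine ⟨P.toBlockFactor O hO ⟨g, hg⟩, Subtype.ext (Equiv.ext fun x ↦ Subtype.ext ?_)⟩
    exact (hφ _ x).trans (P.toBlockFactor_apply_of_mem hO ⟨g, hg⟩ x.2)

theorem Sylow.nonempty_mulEquiv_of_equiv [Finite α] {p : ℕ} [Fact p.Prime] {β : Type*} (e : α ≃ β)
    (P : Sylow p (Equiv.Perm α)) (Q : Sylow p (Equiv.Perm β)) : Nonempty (P ≃* Q) := by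
  have : Finite β := .of_equiv α e
  let R : Sylow p (Equiv.Perm β) :=
    P.mapSurjective (f := (e.permCongrHom : Equiv.Perm α →* Equiv.Perm β)) e.permCongrHom.surjective
  exact ⟨(e.permCongrHom.subgroupMap (P : Subgroup (Equiv.Perm α))).trans (R.equiv Q)⟩

end Restriction

/-! ### Orbits of Sylow subgroups. -/

section Transitive

variable {p : ℕ} [hp : Fact p.Prime]

/-- Orbits of a Sylow subgroup are divisible by the prime powers dividing the whole orbit. -/
theorem Sylow.pow_dvd_ncard_orbit {G α : Type*} [Group G] [Finite G] [MulAction G α]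
    (P : Sylow p G) (x : α) {k : ℕ} (h : p ^ k ∣ (orbit G x).ncard) :
    p ^ k ∣ (orbit P x).ncard := by
  rw [← index_stabilizer] at h ⊢
  have h1 : stabilizer P x = (stabilizer G x).subgroupOf P := rfl
  have h2 : (stabilizer G x).index ∣ (stabilizer P x).index * (P : Subgroup G).index := by
    rw [h1, ← Subgroup.relIndex, ← Subgroup.inf_relIndex_right,
      Subgroup.relIndex_mul_index inf_le_right]
    exact Subgroup.index_dvd_of_le inf_le_left
  exact ((hp.out.coprime_iff_not_dvd.2 P.not_dvd_index).pow_left k).dvd_of_dvd_mul_right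
    (h.trans h2)

theorem Sylow.orbit_eq_univ {α : Type*} [Finite α] (P : Sylow p (Equiv.Perm α)) {k : ℕ}
    (hα : Nat.card α = p ^ k) (x : α) : orbit P x = Set.univ := by
  have h : p ^ k ∣ (orbit P x).ncard := P.pow_dvd_ncard_orbit x (by
    rw [MulAction.orbit_eq_univ, Set.ncard_univ, hα])
  refine Set.eq_of_subset_of_ncard_le (Set.subset_univ _) ?_
  rw [Set.ncard_univ, hα]
  exact Nat.le_of_dvd ((Set.ncard_pos).2 ⟨x, mem_orbit_self x⟩) h

/-- An invariant set of prime power size is an orbit. -/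
theorem Sylow.orbit_eq_of_ncard {α : Type*} [Finite α] (P : Sylow p (Equiv.Perm α)) {O : Set α}
    (hO : (P : Subgroup (Equiv.Perm α)) ≤ stabilizer (Equiv.Perm α) O) {k : ℕ}
    (hk : O.ncard = p ^ k) {x : α} (hx : x ∈ O) : orbit P x = O := by
  refine Set.Subset.antisymm ?_ fun y hy ↦ ?_
  · rintro _ ⟨g, rfl⟩
    exact (mem_stabilizer_set.1 (hO g.2) x).2 hx
  · have h := (P.restrict O hO).orbit_eq_univ (k := k) (by rwa [Nat.card_coe_set_eq]) ⟨x, hx⟩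
    obtain ⟨⟨σ, hσ⟩, h⟩ : (⟨y, hy⟩ : O) ∈ orbit (P.restrict O hO) (⟨x, hx⟩ : O) := by
      rw [h]; trivial
    obtain ⟨g, hg, rfl⟩ := Sylow.mem_restrict.1 hσ
    exact ⟨⟨g, hg⟩, congrArg Subtype.val h⟩

theorem Subgroup.le_stabilizer_orbit {G α : Type*} [Group G] [MulAction G α] (H : Subgroup G)
    (x : α) : H ≤ stabilizer G (orbit H x) := fun g hg ↦ by
  rw [mem_stabilizer_set]
  refine fun b ↦ ⟨fun h ↦ ?_, fun h ↦ mem_orbit_of_mem_orbit (⟨g, hg⟩ : H) h⟩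
  have h' := mem_orbit_of_mem_orbit (⟨g, hg⟩ : H)⁻¹ h
  rwa [show g • b = (⟨g, hg⟩ : H) • b from rfl, inv_smul_smul] at h'

/-- Distinct orbits of a Sylow `2`-subgroup of a symmetric group have distinct sizes. -/
theorem Sylow.orbit_eq_orbit_of_ncard {α : Type*} [Finite α] (P : Sylow 2 (Equiv.Perm α))
    {x y : α} {k : ℕ} (hx : (orbit P x).ncard = 2 ^ k) (hy : (orbit P y).ncard = 2 ^ k) :
    orbit P x = orbit P y := by
  by_contra hne
  have hd : Disjoint (orbit P x) (orbit P y) := (orbit.eq_or_disjoint x y).resolve_left hne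
  -- For `p = 2` the union of two orbits of equal size again has prime power size, so it would
  -- itself be a single orbit.
  have hcard : (orbit P x ∪ orbit P y).ncard = 2 ^ (k + 1) := by
    rw [Set.ncard_union_eq hd, hx, hy, pow_succ, mul_two]
  have hst : (P : Subgroup (Equiv.Perm α)) ≤
      stabilizer (Equiv.Perm α) (orbit P x ∪ orbit P y) := fun g hg ↦ by
    rw [mem_stabilizer_set]
    intro b
    exact or_congr (mem_stabilizer_set.1 (Subgroup.le_stabilizer_orbit _ x hg) b)
      (mem_stabilizer_set.1 (Subgroup.le_stabilizer_orbit _ y hg) b)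
  have h1 := P.orbit_eq_of_ncard hst hcard (Or.inl (mem_orbit_self x))
  have h2 := P.orbit_eq_of_ncard hst hcard (Or.inr (mem_orbit_self y))
  exact hne (h1.trans h2.symm)

-- A `p`-group acting on the `a`-subsets has a fixed point when their number is prime to `p`.
open scoped Classical in
theorem IsPGroup.exists_le_stabilizer_of_not_dvd_choose {α : Type*} [Finite α]
    {H : Subgroup (Equiv.Perm α)} (hH : IsPGroup p H) {a : ℕ}
    (ha : ¬ p ∣ (Nat.card α).choose a) :
    ∃ O : Set α, O.ncard = a ∧ H ≤ stabilizer (Equiv.Perm α) O := by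
  obtain ⟨s, hs⟩ := hH.nonempty_fixed_point_of_prime_not_dvd_card (Set.powersetCard α a)
    (by rwa [Set.powersetCard.card])
  refine ⟨(s : Finset α), by simp, fun g hg ↦ ?_⟩
  have h : g ∈ stabilizer (Equiv.Perm α) s := hs ⟨g, hg⟩
  rw [Set.powersetCard.stabilizer_coe] at h
  exact h

end Transitive

/-! ### The center in the transitive case. -/

section Center

/-- The center of a Sylow `2`-subgroup of the symmetric group on `2 ^ k` points has order two. -/
theorem Sylow.card_center_perm {α : Type*} [Finite α] {k : ℕ} (hk : k ≠ 0)
    (hα : Nat.card α = 2 ^ k) (Q : Sylow 2 (Equiv.Perm α)) :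
    Nat.card (Subgroup.center Q) = 2 := by
  classical
  have htrans : ∀ x y : α, ∃ q : Q, (q : Equiv.Perm α) x = y := fun x y ↦ by
    have : y ∈ orbit Q x := by rw [Q.orbit_eq_univ hα]; trivial
    exact this
  have hfree : ∀ w ∈ Subgroup.center Q, ∀ x, (w : Equiv.Perm α) x = x → w = 1 := by
    intro w hw x hx
    refine Subtype.ext (Equiv.ext fun y ↦ ?_)
    obtain ⟨q, rfl⟩ := htrans x y
    have h := congrArg (fun t : Q ↦ (t : Equiv.Perm α) x) (Subgroup.mem_center_iff.1 hw q)
    change (q : Equiv.Perm α) ((w : Equiv.Perm α) x) = (w : Equiv.Perm α) ((q : Equiv.Perm α) x) at h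
    rw [hx] at h
    exact h.symm
  have hnt : Nontrivial Q := by
    have : Nontrivial α := by
      rw [← Finite.one_lt_card_iff_nontrivial, hα]
      exact Nat.one_lt_two_pow hk
    obtain ⟨x, y, hxy⟩ := exists_pair_ne α
    obtain ⟨q, hq⟩ := htrans x y
    refine ⟨q, 1, fun h ↦ hxy ?_⟩
    rw [← hq, h]; rfl
  have hZ : Nontrivial (Subgroup.center Q) := Q.isPGroup'.center_nontrivial
  have hZp : IsPGroup 2 (Subgroup.center Q) := Q.isPGroup'.to_subgroup _
  obtain ⟨z, hz⟩ : ∃ z : Subgroup.center Q, orderOf z = 2 := by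
    obtain ⟨n, hn, h⟩ := hZp.nontrivial_iff_card.1 hZ
    exact exists_prime_orderOf_dvd_card' 2 (h ▸ dvd_pow_self 2 hn.ne')
  have hz1 : z ≠ 1 := by rintro rfl; simp at hz
  set ζ : Equiv.Perm α := ((z : Q) : Equiv.Perm α) with hζ
  have hζζ (x) : ζ (ζ x) = x := by
    have h : z * z = 1 := by
      have h := pow_orderOf_eq_one z
      rwa [hz, sq] at h
    exact congrArg (fun t : Subgroup.center Q ↦ ((t : Q) : Equiv.Perm α) x) h
  have hζx (x) : ζ x ≠ x := fun h ↦ hz1 (Subtype.ext (hfree z z.2 x h))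
  have hζc (q : Q) (x) : (q : Equiv.Perm α) (ζ x) = ζ ((q : Equiv.Perm α) x) :=
    congrArg (fun t : Q ↦ (t : Equiv.Perm α) x) (Subgroup.mem_center_iff.1 z.2 q)
  have hsq (g : Equiv.Perm α) (hg : ∀ x, g x = x ∨ g x = ζ x) (x) : g (g x) = x := by
    rcases hg x with h | h
    · rw [h, h]
    · rcases hg (ζ x) with h' | h'
      · exact absurd (g.injective (h'.trans h.symm)) (hζx x)
      · rw [h, h', hζζ]
  -- `E` fixes or swaps each pair `{x, ζ x}`. It has exponent dividing 2, and `Q` normalizes it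
  -- since `Q` commutes with `ζ`.
  let E : Subgroup (Equiv.Perm α) :=
    { carrier := {g | ∀ x, g x = x ∨ g x = ζ x}
      one_mem' := fun x ↦ Or.inl rfl
      mul_mem' := fun {g h} hg hh x ↦ by
        rw [Equiv.Perm.mul_apply]
        rcases hh x with h1 | h1 <;> rcases hg (h x) with h2 | h2 <;> rw [h2, h1]
        · exact Or.inl rfl
        · exact Or.inr rfl
        · exact Or.inr rfl
        · exact Or.inl (hζζ x)
      inv_mem' := fun {g} hg x ↦ by
        have : g⁻¹ x = g x := by rw [Equiv.Perm.inv_eq_iff_eq, hsq g hg]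
        rw [this]; exact hg x }
  have hE : IsPGroup 2 E := fun g ↦ ⟨1, Subtype.ext (Equiv.ext fun x ↦ by
    rw [pow_one, sq]; exact hsq g g.2 x)⟩
  have hEQ : E ≤ Q := by
    refine Q.le_of_le_normalizer hE (Subgroup.le_normalizer_of_conj_mem fun q hq g hg x ↦ ?_)
    rw [Equiv.Perm.mul_apply, Equiv.Perm.mul_apply]
    have hqx : q (q⁻¹ x) = x := by rw [← Equiv.Perm.mul_apply, mul_inv_cancel, Equiv.Perm.one_apply]
    rcases hg (q⁻¹ x) with h | h
    · left; rw [h, hqx]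
    · right; rw [h, hζc ⟨q, hq⟩, hqx]
  have hswap (x) : Equiv.swap x (ζ x) ∈ E := fun y ↦ by
    rcases eq_or_ne y x with rfl | h1
    · right; exact Equiv.swap_apply_left _ _
    · rcases eq_or_ne y (ζ x) with rfl | h2
      · right; rw [Equiv.swap_apply_right, hζζ]
      · left; exact Equiv.swap_apply_of_ne_of_ne h1 h2
  have hZ2 : ∀ w : Subgroup.center Q, w = 1 ∨ w = z := by
    intro w
    obtain ⟨x⟩ : Nonempty α := by
      by_contra h
      rw [not_nonempty_iff] at h
      exact pow_ne_zero k two_ne_zero (hα.symm.trans Nat.card_of_isEmpty)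
    -- Commuting with `w`, the swap sends `w x` to `w (ζ x) = ζ (w x) ≠ w x`, so `w x` is `x` or `ζ
    -- x`.
    have hc : Equiv.swap x (ζ x) (((w : Q) : Equiv.Perm α) x) =
        ((w : Q) : Equiv.Perm α) (Equiv.swap x (ζ x) x) :=
      congrArg (fun t : Q ↦ (t : Equiv.Perm α) x)
        (Subgroup.mem_center_iff.1 w.2 ⟨_, hEQ (hswap x)⟩)
    rw [Equiv.swap_apply_left, hζc] at hc
    by_cases h1 : ((w : Q) : Equiv.Perm α) x = x
    · exact Or.inl (Subtype.ext (hfree w w.2 x h1))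
    · right
      by_cases h2 : ((w : Q) : Equiv.Perm α) x = ζ x
      · have h3 : ((z⁻¹ * w : Subgroup.center Q) : Q) = 1 := by
          refine hfree _ (z⁻¹ * w).2 x ?_
          change ζ⁻¹ (((w : Q) : Equiv.Perm α) x) = x
          rw [h2, ← Equiv.Perm.mul_apply, inv_mul_cancel, Equiv.Perm.one_apply]
        exact (inv_mul_eq_one.1 (Subtype.ext h3)).symm
      · rw [Equiv.swap_apply_of_ne_of_ne h1 h2] at hc
        exact absurd hc.symm (hζx _)
  rw [Nat.card_eq_two_iff]
  exact ⟨1, z, hz1.symm, Set.eq_univ_of_forall fun w ↦ hZ2 w⟩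

end Center

/-! ### Parity of the binomial coefficient. -/

section Binomial

/-- Lucas at `p = 2`: the last binary digit of `2 ^ (k + 1)` is 0, so each step just halves both
arguments. -/
theorem Nat.choose_two_pow_modEq (k n : ℕ) : n.choose (2 ^ k) ≡ n / 2 ^ k [MOD 2] := by
  have := Nat.fact_prime_two
  induction k generalizing n with
  | zero => simp [Nat.ModEq.refl]
  | succ k ih =>
    have h := Choose.choose_modEq_choose_mod_mul_choose_div_nat (p := 2) (n := n) (k := 2 ^ (k + 1))
    have h1 : 2 ^ (k + 1) % 2 = 0 := by rw [pow_succ]; exact Nat.mul_mod_left _ _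
    have h2 : 2 ^ (k + 1) / 2 = 2 ^ k := by rw [pow_succ]; exact Nat.mul_div_cancel _ two_pos
    rw [h1, h2, Nat.choose_zero_right, one_mul] at h
    refine h.trans ((ih (n / 2)).trans ?_)
    rw [Nat.div_div_eq_div_mul, pow_succ']

/-- Smaller exponents sum to less than `2 ^ k i`; larger ones contribute a multiple of `2 ^ (k i +
1)`. -/
theorem odd_sum_two_pow_div {ι : Type*} [Fintype ι] [LinearOrder ι] {k : ι → ℕ}
    (hk : StrictMono k) (i : ι) : Odd ((∑ j, 2 ^ k j) / 2 ^ k i) := by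
  have hlt : ∑ j with j < i, 2 ^ k j < 2 ^ k i := by
    rw [← Finset.sum_image (f := fun a ↦ 2 ^ a) (g := k) (fun _ _ _ _ h ↦ hk.injective h)]
    refine Nat.geomSum_lt le_rfl ?_
    simp only [Finset.mem_image, Finset.mem_filter]
    rintro _ ⟨j, ⟨-, hj⟩, rfl⟩
    exact hk hj
  obtain ⟨c, hc⟩ : 2 ^ (k i + 1) ∣ ∑ j with i < j, 2 ^ k j :=
    Finset.dvd_sum fun j hj ↦ pow_dvd_pow 2 (hk (Finset.mem_filter.1 hj).2)
  have hsum : ∑ j, 2 ^ k j = (∑ j with j < i, 2 ^ k j) + 2 ^ k i * (2 * c + 1) := by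
    rw [← Finset.sum_filter_add_sum_filter_not _ (fun j ↦ j < i)]
    congr 1
    have : Finset.univ.filter (fun j ↦ ¬ j < i) =
        insert i (Finset.univ.filter fun j ↦ i < j) := by
      ext j
      simp [le_iff_eq_or_lt, eq_comm]
    rw [this, Finset.sum_insert (by simp), hc]
    ring
  rw [hsum, Nat.add_mul_div_left _ _ (by positivity), Nat.div_eq_of_lt hlt, zero_add]
  exact odd_two_mul_add_one c

end Binomial

end SylowOfSymmetricGroup

theorem mainTheorem11 (m : ℕ) (k : Fin (m + 1) → ℕ) (hk : StrictMono k)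
    (n : ℕ) (hn : n = ∑ j, 2 ^ k j)
    (P : Sylow 2 (Equiv.Perm (Fin n)))
    (i : Fin (m + 1)) (hi : 2 < k i)
    (Q : Sylow 2 (Equiv.Perm (Fin (2 ^ k i)))) :
    (∃! O : Set (Fin n), IsOrbitOf (P : Subgroup (Equiv.Perm (Fin n))) O ∧ O.ncard = 2 ^ k i) ∧
    (∀ O : Set (Fin n), IsOrbitOf (P : Subgroup (Equiv.Perm (Fin n))) O → O.ncard = 2 ^ k i →
      Nonempty (blockFactor (P : Subgroup (Equiv.Perm (Fin n))) O ≃* Q) ∧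
      ∃ _ : (blockFactor (P : Subgroup (Equiv.Perm (Fin n))) O).Normal,
        Nonempty
          (Subgroup.centralizer
              (blockFactor (P : Subgroup (Equiv.Perm (Fin n))) O :
                Set (P : Subgroup (Equiv.Perm (Fin n)))) ≃*
            ((P : Subgroup (Equiv.Perm (Fin n))) ⧸
                blockFactor (P : Subgroup (Equiv.Perm (Fin n))) O) ×
              Subgroup.center Q)) ∧
    Nonempty (Subgroup.center Q ≃* Multiplicative (ZMod 2)) := by
  have := Nat.fact_prime_two
  refine ⟨?_, ?_, ?_⟩
  · obtain ⟨O, hO, hst⟩ := P.isPGroup'.exists_le_stabilizer_of_not_dvd_choose (a := 2 ^ k i) (by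
      rw [Nat.card_fin, Nat.dvd_iff_mod_eq_zero, Nat.choose_two_pow_modEq, hn,
        Nat.odd_iff.1 (odd_sum_two_pow_div hk i)]
      exact one_ne_zero)
    obtain ⟨x, hx⟩ : O.Nonempty := by
      rw [← Set.ncard_pos, hO]
      positivity
    refine ⟨O, ⟨⟨x, (P.orbit_eq_of_ncard hst hO hx).symm⟩, hO⟩, ?_⟩
    rintro _ ⟨⟨y, rfl⟩, hy⟩
    have hxO := P.orbit_eq_of_ncard hst hO hx
    exact (P.orbit_eq_orbit_of_ncard hy (hxO ▸ hO)).trans hxO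
  · rintro O ⟨x, rfl⟩ hcard
    have hst := Subgroup.le_stabilizer_orbit (P : Subgroup (Equiv.Perm (Fin n))) x
    obtain ⟨e⟩ := P.nonempty_blockFactor_mulEquiv_restrict hst
    obtain ⟨e'⟩ := (P.restrict _ hst).nonempty_mulEquiv_of_equiv
      (Finite.equivFinOfCardEq ((Nat.card_coe_set_eq _).trans hcard)) Q
    refine ⟨⟨e.trans e'⟩, blockFactor_normal hst, ?_⟩
    obtain ⟨c⟩ := nonempty_centralizer_mulEquiv_of_retraction (blockFactor_normal hst)
      (P.toBlockFactor _ hst) (P.toBlockFactor_coe hst)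
    have := blockFactor_normal hst
    exact ⟨c.trans (MulEquiv.prodCongr (MulEquiv.refl _)
      (Subgroup.centerCongr (e.trans e')))⟩
  · refine ⟨mulEquivOfPrimeCardEq (p := 2) (Q.card_center_perm (by lia) (Nat.card_fin _)) ?_⟩
    rw [Nat.card_congr Multiplicative.toAdd, Nat.card_zmod]
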